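/- **Definitions.** An integer $r\times r$ matrix $B=(b_{ij})$ is skew-symmetrizable if $DB$ is skew-symmetric for some diagonal matrix $D$ with positive integer diagonal entries. Let $\mathcal F$ be a field isomorphic to the field of rational functions in $r$ variables over $\mathbb{Q}$. A seed in $\mathcal F$ is a pair $(\mathbf x,B)$, where $\mathbf x=(x_1,\dots,x_r)$ is an $r$-tuple of algebraically independent elements generating the field $\mathcal F$ over $\mathbb{Q}$, and $B$ is a skew-symmetrizable integer $r\times r$ matrix. Write $[a]_+=\max(a,0)$. For $k\in\{1,\dots,r\}$ the mutated seed $\mu_k(\mathbf x,B)=(\mathbf x',B')$ is given by $x_i'=x_i$ for $i\ne k$, $$x_k'=x_k^{-1}\Big(\prod_{j=1}^r x_j^{[b_{jk}]_+}+\prod_{j=1}^r x_j^{[-b_{jk}]_+}\Big),$$ and $b_{ij}'=-b_{ij}$ if $i=k$ or $j=k$, and $b'_{ij}=b_{ij}+[b_{ik}]_+b_{kj}+b_{ik}[-b_{kj}]_+$ otherwise. Let $\mathbb T_r$ be the $r$-regular tree whose edges are labeled by $1,\dots,r$ so that each vertex lies on exactly one edge of each label. A cluster pattern is a family of seeds $\Sigma_t=((x_{1;t},\dots,x_{r;t}),B_t)$,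 indexed by the vertices $t$ of $\mathbb T_r$, with $\Sigma_{t'}=\mu_k(\Sigma_t)$ whenever $t$ and $t'$ are joined by an edge labeled $k$. Fix an initial vertex $t_0$ and put $x_i=x_{i;t_0}$. A mutation invariant is a non-constant rational function $\mathcal T\in\mathbb{Q}(x_1,\dots,x_r)$ such that $\mathcal T(x_1,\dots,x_r)=\mathcal T(x_{1;t},\dots,x_{r;t})$ for every vertex $t$ of $\mathbb T_r$. It is a Laurent mutation invariant if moreover $\mathcal T\in\mathbb{Q}[x_1^{\pm1},\dots,x_r^{\pm1}]$. **Theorem.** Let $m,n$ be non-negative integers with $mn\ge 5$ (non-affine type). Then a cluster pattern of rank $2$ with initial exchange matrix $$B_{t_0}=\begin{pmatrix}0&m\\-n&0\end{pmatrix}$$ has no Laurent mutation invariant. -/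

import Mathlib

namespace ClusterAlgebra

/-- An integer square matrix `B` is skew-symmetrizable if `D * B` is skew-symmetric for some
diagonal matrix `D` with positive integer diagonal entries. -/
def IsSkewSymmetrizable {n : ℕ} (B : Matrix (Fin n) (Fin n) ℤ) : Prop :=
  ∃ d : Fin n → ℤ, (∀ i, 0 < d i) ∧
    (Matrix.diagonal d * B).transpose = -(Matrix.diagonal d * B)

theorem isSkewSymmetrizable_iff {n : ℕ} (B : Matrix (Fin n) (Fin n) ℤ) :
    IsSkewSymmetrizable B ↔
      ∃ d : Fin n → ℤ, (∀ i, 0 < d i) ∧ ∀ i j, d j * B j i = -(d i * B i j) := by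
  unfold IsSkewSymmetrizable
  refine exists_congr fun d => and_congr_right fun _ => ?_
  rw [← Matrix.ext_iff]
  simp [Matrix.diagonal_mul]

theorem IsSkewSymmetrizable.diag_eq_zero {n : ℕ} {B : Matrix (Fin n) (Fin n) ℤ}
    (h : IsSkewSymmetrizable B) (i : Fin n) : B i i = 0 := by
  obtain ⟨d, hd, h⟩ := (isSkewSymmetrizable_iff B).1 h
  have h1 := h i i
  have h2 : d i * B i i = 0 := by linarith
  exact (mul_eq_zero.1 h2).resolve_left (hd i).ne'

/-- Matrix mutation in direction `k`. -/
def mutateMatrix {n : ℕ} (k : Fin n) (B : Matrix (Fin n) (Fin n) ℤ) :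
    Matrix (Fin n) (Fin n) ℤ :=
  Matrix.of fun i j =>
    if i = k ∨ j = k then -B i j
    else B i j + max (B i k) 0 * B k j + B i k * max (-B k j) 0

theorem IsSkewSymmetrizable.mutateMatrix {n : ℕ} {B : Matrix (Fin n) (Fin n) ℤ}
    (h : IsSkewSymmetrizable B) (k : Fin n) :
    IsSkewSymmetrizable (ClusterAlgebra.mutateMatrix k B) := by
  obtain ⟨d, hd, h⟩ := (isSkewSymmetrizable_iff B).1 h
  refine (isSkewSymmetrizable_iff _).2 ⟨d, hd, fun i j => ?_⟩
  have key : ∀ a b : Fin n, d a * max (B a b) 0 = d b * max (-B b a) 0 := by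
    intro a b
    rw [mul_max_of_nonneg _ _ (hd a).le, mul_max_of_nonneg _ _ (hd b).le, h b a]
    simp
  simp only [ClusterAlgebra.mutateMatrix, Matrix.of_apply]
  by_cases hij : i = k ∨ j = k
  · rw [if_pos hij, if_pos hij.symm]
    have := h i j
    linarith
  · rw [if_neg hij, if_neg fun h' => hij h'.symm]
    linear_combination h i j + key j k * B k i + key i k * B k j +
      max (-B k j) 0 * h i k + max (-B k i) 0 * h j k

/-- A (labeled) seed of rank `n` in the field `F`: an `n`-tuple of algebraically independent
elements generating `F` as a field over `ℚ`, with a skew-symmetrizable integer matrix.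
The existence of a seed forces `F` to be isomorphic to the field of rational functions in `n`
variables over `ℚ`. -/
@[ext]
structure Seed (n : ℕ) (F : Type*) [Field F] [Algebra ℚ F] where
  x : Fin n → F
  B : Matrix (Fin n) (Fin n) ℤ
  algebraicIndependent : AlgebraicIndependent ℚ x
  adjoin_eq_top : IntermediateField.adjoin ℚ (Set.range x) = ⊤
  isSkewSymmetrizable : IsSkewSymmetrizable B

/-- Mutation of a cluster in direction `k` with respect to the exchange matrix `B`;
the integer `max b 0` is written as `b.toNat` in the exponents. -/
def mutateCluster {n : ℕ} {F : Type*} [Field F] (k : Fin n) (B : Matrix (Fin n) (Fin n) ℤ)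
    (x : Fin n → F) : Fin n → F :=
  fun i =>
    if i = k then
      (x k)⁻¹ * (∏ j, x j ^ (B j k).toNat + ∏ j, x j ^ (-B j k).toNat)
    else x i

section Mutation

variable {n : ℕ} {F : Type*} [Field F] [Algebra ℚ F]

theorem algebraicIndependent_of_adjoin_eq_top {x y : Fin n → F}
    (hx : AlgebraicIndependent ℚ x) (hx' : IntermediateField.adjoin ℚ (Set.range x) = ⊤)
    (hy : IntermediateField.adjoin ℚ (Set.range y) = ⊤) : AlgebraicIndependent ℚ y := by
  have alg : ∀ z : Fin n → F, IntermediateField.adjoin ℚ (Set.range z) = ⊤ →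
      Algebra.IsAlgebraic (Algebra.adjoin ℚ (Set.range z)) F := by
    intro z hz
    refine ⟨fun a => ?_⟩
    have ha : a ∈ IntermediateField.adjoin ℚ (Set.range z) := hz ▸ IntermediateField.mem_top
    obtain ⟨r, hr, s, hs, rfl⟩ := IntermediateField.mem_adjoin_iff_div.1 ha
    rw [div_eq_mul_inv]
    exact (isAlgebraic_algebraMap (⟨r, hr⟩ : Algebra.adjoin ℚ (Set.range z))).mul
      (isAlgebraic_algebraMap (⟨s, hs⟩ : Algebra.adjoin ℚ (Set.range z))).inv
  have hax := alg x hx'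
  have hay := alg y hy
  have hb : IsTranscendenceBasis ℚ x := hx.isTranscendenceBasis_iff_isAlgebraic.2 hax
  exact (Algebra.IsAlgebraic.isTranscendenceBasis_of_lift_le_trdeg_of_finite ℚ y hb.lift_cardinalMk_eq_trdeg.le).1

theorem Seed.x_ne_zero (S : Seed n F) (i : Fin n) : S.x i ≠ 0 :=
  S.algebraicIndependent.ne_zero i

theorem Seed.mutateCluster_adjoin (S : Seed n F) (k : Fin n) :
    IntermediateField.adjoin ℚ (Set.range (mutateCluster k S.B S.x)) = ⊤ := by
  set K := IntermediateField.adjoin ℚ (Set.range (mutateCluster k S.B S.x)) with hK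
  have hmem : ∀ i, mutateCluster k S.B S.x i ∈ K := fun i =>
    IntermediateField.subset_adjoin _ _ ⟨i, rfl⟩
  have hne : ∀ i, i ≠ k → S.x i ∈ K := by
    intro i hi
    have := hmem i
    rwa [mutateCluster, if_neg hi] at this
  have hprod : ∀ e : Fin n → ℕ, e k = 0 → ∏ j, S.x j ^ e j ∈ K := by
    intro e he
    refine prod_mem fun j _ => ?_
    by_cases hj : j = k
    · subst hj
      rw [he, pow_zero]
      exact one_mem _
    · exact pow_mem (hne j hj) _
  have hd := S.isSkewSymmetrizable.diag_eq_zero k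
  set P := ∏ j, S.x j ^ (S.B j k).toNat + ∏ j, S.x j ^ (-S.B j k).toNat with hP
  have hPK : P ∈ K :=
    add_mem (hprod (fun j => (S.B j k).toNat) (by simp [hd]))
      (hprod (fun j => (-S.B j k).toNat) (by simp [hd]))
  have hPne : P ≠ 0 := by
    intro h0
    let p : MvPolynomial (Fin n) ℚ :=
      ∏ j, MvPolynomial.X j ^ (S.B j k).toNat + ∏ j, MvPolynomial.X j ^ (-S.B j k).toNat
    have hp : MvPolynomial.aeval S.x p = 0 := by
      simpa [p, hP] using h0
    have hp0 : p = 0 := S.algebraicIndependent.eq_zero_of_aeval_eq_zero p hp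
    have := congrArg (MvPolynomial.eval fun _ => (1 : ℚ)) hp0
    norm_num [p] at this
  have hk : S.x k ∈ K := by
    have h1 := hmem k
    rw [mutateCluster, if_pos rfl, ← hP] at h1
    have h2 := mul_mem hPK (inv_mem h1)
    have h3 : P * ((S.x k)⁻¹ * P)⁻¹ = S.x k := by
      have := S.x_ne_zero k
      field_simp
    rwa [h3] at h2
  rw [eq_top_iff, ← S.adjoin_eq_top, IntermediateField.adjoin_le_iff]
  rintro _ ⟨i, rfl⟩
  by_cases hi : i = k
  · subst hi
    exact hk
  · exact hne i hi

/-- Mutation of a seed in direction `k`. -/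
def Seed.mutate (k : Fin n) (S : Seed n F) : Seed n F where
  x := mutateCluster k S.B S.x
  B := mutateMatrix k S.B
  algebraicIndependent := algebraicIndependent_of_adjoin_eq_top S.algebraicIndependent
    S.adjoin_eq_top (S.mutateCluster_adjoin k)
  adjoin_eq_top := S.mutateCluster_adjoin k
  isSkewSymmetrizable := S.isSkewSymmetrizable.mutateMatrix k

/-- The substitution `T ↦ T(x₁, …, xₙ)` of the cluster of a seed into rational functions over `ℚ`,
which is well defined because the cluster is algebraically independent. -/
noncomputable def Seed.eval (S : Seed n F) :
    FractionRing (MvPolynomial (Fin n) ℚ) →ₐ[ℚ] F :=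
  IsFractionRing.liftAlgHom (g := MvPolynomial.aeval S.x) S.algebraicIndependent

end Mutation

/-- The `n`-regular tree on the vertex set `V`, its edges labeled by `Fin n` in such a way that
each vertex is incident with exactly one edge of each label. -/
structure RegularTree (n : ℕ) (V : Type*) where
  graph : SimpleGraph V
  isTree : graph.IsTree
  label : graph.edgeSet → Fin n
  existsUnique_adj (t : V) (k : Fin n) : ∃! t' : V, ∃ h : graph.Adj t t', label ⟨s(t, t'), h⟩ = k

/-- A cluster pattern: a family of seeds indexed by the vertices of the `n`-regular tree, such that
the seeds at the two ends of an edge with label `k` are obtained from each other by mutation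
in direction `k`. -/
structure ClusterPattern {n : ℕ} {V : Type*} (𝕋 : RegularTree n V)
    (F : Type*) [Field F] [Algebra ℚ F] where
  seed : V → Seed n F
  seed_eq_mutate (t t' : V) (h : 𝕋.graph.Adj t t') :
    seed t' = (seed t).mutate (𝕋.label ⟨s(t, t'), h⟩)

/-- The ring of Laurent polynomials over `ℚ` inside the field of rational functions. -/
noncomputable def laurentPolynomials (n : ℕ) :
    Subalgebra ℚ (FractionRing (MvPolynomial (Fin n) ℚ)) :=
  Algebra.adjoin ℚ
    (Set.range (fun i : Fin n => algebraMap (MvPolynomial (Fin n) ℚ)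
        (FractionRing (MvPolynomial (Fin n) ℚ)) (MvPolynomial.X i)) ∪
      Set.range (fun i : Fin n => (algebraMap (MvPolynomial (Fin n) ℚ)
        (FractionRing (MvPolynomial (Fin n) ℚ)) (MvPolynomial.X i))⁻¹))

section Invariant

variable {n : ℕ} {V : Type*} {𝕋 : RegularTree n V} {F : Type*} [Field F] [Algebra ℚ F]

/-- A mutation invariant of the cluster algebra with cluster pattern `P` and initial vertex `t₀`:
a non-constant rational function which takes the same value at all clusters. -/
def ClusterPattern.IsMutationInvariant (P : ClusterPattern 𝕋 F) (t₀ : V)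
    (T : FractionRing (MvPolynomial (Fin n) ℚ)) : Prop :=
  (¬ ∃ c : ℚ, T = algebraMap ℚ _ c) ∧ ∀ t : V, (P.seed t₀).eval T = (P.seed t).eval T

/-- A Laurent mutation invariant is a mutation invariant which is a Laurent polynomial. -/
def ClusterPattern.IsLaurentMutationInvariant (P : ClusterPattern 𝕋 F) (t₀ : V)
    (T : FractionRing (MvPolynomial (Fin n) ℚ)) : Prop :=
  P.IsMutationInvariant t₀ T ∧ T ∈ laurentPolynomials n

end Invariant

end ClusterAlgebra

/-! Subtract its constant term from `T`; only invariance under the two mutations at `t₀` is needed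
to show that the difference vanishes. If `A_i(x₂)` is the coefficient of `x₁^i`, substituting `x₁ ↦
(x₂^n + 1)/x₁` gives `A_{-i} = A_i (x₂^n + 1)^i`. Comparing degrees, every exponent `(i, j)` of the
support has a partner `(-i, j')` with `j' ≥ j + n i`; the other mutation acts likewise with `m`
(`exists_coeff_ne_zero_of_relation`).

Hence the support function `h(a, b) = max (a i + b j)` is unchanged by `(a, b) ↦ (n b - a, b)` for
`b ≥ 0` and by `(a, b) ↦ (a, m a - b)` for `a ≥ 0`. The composite has determinant 1 and trace `m n -
2 ≥ 3`, so it is hyperbolic, and the orbit of `(n, 2)` stays in the positive quadrant. Along this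
orbit `h` is constant, so some point of the finite support attains the same value infinitely often.
Nonzero linear forms grow along a hyperbolic orbit, so that point is the origin, whose coefficient
was removed (`eq_empty_of_tropical_invariant`). -/

namespace ClusterAlgebra

/-! ### Support functions and the dynamics of tropical mutations -/

/-- A nonzero integer solution of `u (k + 2) = N * u (k + 1) - u k` with `N ≥ 3` takes each value
only finitely often. -/
theorem finite_setOf_eq_of_recurrence {N : ℤ} (hN : 3 ≤ N) {u : ℕ → ℤ}
    (hu : ∀ k, u (k + 2) = N * u (k + 1) - u k) (h0 : u 0 ≠ 0 ∨ u 1 ≠ 0) (c : ℤ) :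
    {k | u k = c}.Finite := by
  have hne : ∀ k, u k ≠ 0 ∨ u (k + 1) ≠ 0 := by
    intro k
    induction k with
    | zero => exact h0
    | succ k ih =>
      by_contra! h
      have h1 := hu k
      rw [h.2, h.1] at h1
      rcases ih with h' | h'
      · exact h' (by linarith)
      · exact h' h.1
  have hstep : ∀ k, |u k| ≤ |u (k + 1)| → |u (k + 1)| < |u (k + 2)| := by
    intro k hk
    have hpos : 0 < |u (k + 1)| := by
      rcases hne k with h | h
      · exact (abs_pos.2 h).trans_le hk
      · exact abs_pos.2 h
    have h1 : N * |u (k + 1)| ≤ |u (k + 2)| + |u k| := by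
      have h2 : N * u (k + 1) = u (k + 2) + u k := by rw [hu]; ring
      calc N * |u (k + 1)| = |N * u (k + 1)| := by rw [abs_mul, abs_of_nonneg (show 0 ≤ N by linarith)]
        _ ≤ _ := by rw [h2]; exact abs_add_le _ _
    nlinarith
  -- Absolute values cannot decrease forever; after the first non-decrease, `hstep` makes them grow
  -- strictly.
  obtain ⟨K, hK⟩ : ∃ K, |u K| ≤ |u (K + 1)| := by
    by_contra! h
    exact not_strictAnti_of_wellFoundedLT (fun k => (u k).natAbs)
      (strictAnti_nat_of_succ_lt fun k => by
        have := h k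
        rwa [Int.abs_eq_natAbs, Int.abs_eq_natAbs, Nat.cast_lt] at this)
  have hle : ∀ j, |u (K + j)| ≤ |u (K + j + 1)| := by
    intro j
    induction j with
    | zero => exact hK
    | succ j ih => exact (hstep _ ih).le
  have hmono : StrictMono fun j => |u (K + 1 + j)| := by
    refine strictMono_nat_of_lt_succ fun j => ?_
    have := hstep _ (hle j)
    rwa [show K + j + 1 = K + 1 + j by ring, show K + j + 2 = K + 1 + (j + 1) by ring] at this
  by_contra hinf
  obtain ⟨a, ha, ha'⟩ := Set.Infinite.exists_gt hinf (K + 1)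
  obtain ⟨b, hb, hb'⟩ := Set.Infinite.exists_gt hinf a
  obtain ⟨a, rfl⟩ := Nat.exists_eq_add_of_le ha'.le
  obtain ⟨b, rfl⟩ := Nat.exists_eq_add_of_le (ha'.trans hb').le
  have h1 : u (K + 1 + a) = c := ha
  have h2 : u (K + 1 + b) = c := hb
  have := hmono.injective (show |u (K + 1 + a)| = |u (K + 1 + b)| by rw [h1, h2])
  omega

/-- `V` is the maximum over `S` of the linear form with coefficients `w`. -/
def IsMaxOfForm (S : Finset (ℤ × ℤ)) (w : ℤ × ℤ) (V : ℤ) : Prop :=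
  (∃ p ∈ S, w.1 * p.1 + w.2 * p.2 = V) ∧ ∀ p ∈ S, w.1 * p.1 + w.2 * p.2 ≤ V

/-- Since `(n b - a) i + b j = a (-i) + b (j + n i)`, passing to the partner point cannot decrease
the value when `b ≥ 0`. The reflection is an involution, so this one-sided hypothesis bounds the new
maximum from both sides. -/
theorem IsMaxOfForm.reflect_fst {S : Finset (ℤ × ℤ)} {n a b V : ℤ} (h : IsMaxOfForm S (a, b) V)
    (hS : ∀ i j, (i, j) ∈ S → ∃ j', j + n * i ≤ j' ∧ (-i, j') ∈ S) (hb : 0 ≤ b) :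
    IsMaxOfForm S (n * b - a, b) V := by
  obtain ⟨⟨⟨i, j⟩, hp, hV⟩, hle⟩ := h
  have hle' : ∀ p ∈ S, (n * b - a) * p.1 + b * p.2 ≤ V := by
    rintro ⟨i, j⟩ hp
    obtain ⟨j', hj, hj'⟩ := hS i j hp
    have := hle _ hj'
    dsimp only at this ⊢
    nlinarith
  refine ⟨?_, hle'⟩
  obtain ⟨j', hj, hj'⟩ := hS i j hp
  refine ⟨_, hj', le_antisymm (hle' _ hj') ?_⟩
  dsimp only at hV ⊢
  nlinarith

theorem IsMaxOfForm.swap {S : Finset (ℤ × ℤ)} {w : ℤ × ℤ} {V : ℤ} (h : IsMaxOfForm S w V) :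
    IsMaxOfForm (S.image Prod.swap) w.swap V := by
  obtain ⟨⟨p, hp, hV⟩, hle⟩ := h
  refine ⟨⟨p.swap, Finset.mem_image_of_mem _ hp, ?_⟩, fun q hq => ?_⟩
  · simp only [Prod.fst_swap, Prod.snd_swap]; linarith
  · obtain ⟨r, hr, rfl⟩ := Finset.mem_image.1 hq
    have := hle r hr
    simp only [Prod.fst_swap, Prod.snd_swap]; linarith

theorem IsMaxOfForm.reflect_snd {S : Finset (ℤ × ℤ)} {m a b V : ℤ} (h : IsMaxOfForm S (a, b) V)
    (hS : ∀ i j, (i, j) ∈ S → ∃ i', i + m * j ≤ i' ∧ (i', -j) ∈ S) (ha : 0 ≤ a) :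
    IsMaxOfForm S (a, m * a - b) V := by
  have := (h.swap.reflect_fst (n := m) (a := b) (b := a) ?_ ha).swap
  · simpa [Finset.image_image] using this
  · intro i j hij
    obtain ⟨⟨j, i⟩, hp, h⟩ := Finset.mem_image.1 hij
    obtain ⟨rfl, rfl⟩ := Prod.mk.inj h
    obtain ⟨i', h1, h2⟩ := hS _ _ hp
    exact ⟨i', h1, Finset.mem_image_of_mem Prod.swap h2⟩

/-- The orbit of the weight `(n, 2)` under the composition of the two tropical mutations. -/
def tropicalOrbit (m n : ℤ) : ℕ → ℤ × ℤ
  | 0 => (n, 2)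
  | k + 1 =>
    let w := tropicalOrbit m n k
    (n * (m * w.1 - w.2) - w.1, m * w.1 - w.2)

/-- The third inequality closes the induction: it gives `m a - b ≥ b > 0`, and `m n ≥ 5` then
reproduces it. Positivity is what allows both reflections at each stage. -/
theorem tropicalOrbit_pos {m n : ℤ} (hn : 0 < n) (hmn : 5 ≤ m * n) (k : ℕ) :
    0 < (tropicalOrbit m n k).1 ∧ 0 < (tropicalOrbit m n k).2 ∧
      2 * (tropicalOrbit m n k).2 ≤ m * (tropicalOrbit m n k).1 := by
  induction k with
  | zero => simp only [tropicalOrbit]; omega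
  | succ k ih =>
    simp only [tropicalOrbit]
    generalize tropicalOrbit m n k = w at ih ⊢
    obtain ⟨a, b⟩ := w
    obtain ⟨ha, hb, hab⟩ := ih
    dsimp only at *
    have hm : 0 < m := by by_contra! h; nlinarith
    have h1 : 2 * (n * (m * a - b)) ≥ m * n * a := by nlinarith
    have h2 : m * n * a ≥ 5 * a := by nlinarith
    have h3 : 2 * a ≤ n * (m * a - b) := by linarith
    refine ⟨by linarith, by linarith, ?_⟩
    have h4 : m * n * (m * a - b) ≥ 5 * (m * a - b) := by nlinarith
    nlinarith

theorem eq_empty_of_tropical_invariant {S : Finset (ℤ × ℤ)} {m n : ℤ} (hn : 0 < n)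
    (hmn : 5 ≤ m * n) (h0 : (0, 0) ∉ S)
    (h1 : ∀ i j, (i, j) ∈ S → ∃ j', j + n * i ≤ j' ∧ (-i, j') ∈ S)
    (h2 : ∀ i j, (i, j) ∈ S → ∃ i', i + m * j ≤ i' ∧ (i', -j) ∈ S) : S = ∅ := by
  by_contra hne
  obtain ⟨p₀, hp₀, hmax⟩ := S.exists_max_image (fun p => n * p.1 + 2 * p.2)
    (Finset.nonempty_iff_ne_empty.2 hne)
  set V := n * p₀.1 + 2 * p₀.2 with hV
  have hall : ∀ k, IsMaxOfForm S (tropicalOrbit m n k) V := by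
    intro k
    induction k with
    | zero => exact ⟨⟨p₀, hp₀, rfl⟩, hmax⟩
    | succ k ih =>
      have hk := tropicalOrbit_pos hn hmn k
      have hk' := tropicalOrbit_pos hn hmn (k + 1)
      exact (ih.reflect_snd h2 hk.1.le).reflect_fst h1 hk'.2.1.le
  choose p hpS hp using fun k => (hall k).1
  -- Pigeonhole: finitely many points serve as maximizers for infinitely many weights.
  obtain ⟨⟨q, hqS⟩, hq⟩ := Finite.exists_infinite_fiber fun k => (⟨p k, hpS k⟩ : S)
  rw [Set.infinite_coe_iff] at hq
  -- Cayley–Hamilton for the composite of the two reflections: trace `m n - 2`, determinant 1.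
  have hfin := finite_setOf_eq_of_recurrence (N := m * n - 2) (by linarith)
    (u := fun k => (tropicalOrbit m n k).1 * q.1 + (tropicalOrbit m n k).2 * q.2)
    (fun k => by simp only [tropicalOrbit]; ring) ?_ V
  · refine hq (hfin.subset fun k hk => ?_)
    have hkq : p k = q := congrArg Subtype.val hk
    have := hp k
    rwa [hkq] at this
  · by_contra! h
    obtain ⟨i, j⟩ := q
    simp only [tropicalOrbit] at h
    obtain ⟨ha, hb⟩ := h
    have hi : n * (m * n - 4) * i = 0 := by linear_combination 2 * hb - (m * n - 2) * ha
    have hi0 : i = 0 := by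
      rcases mul_eq_zero.1 hi with h | h
      · rcases mul_eq_zero.1 h with h | h <;> omega
      · exact h
    subst hi0
    have hj0 : j = 0 := by linarith
    subst hj0
    exact h0 hqS

end ClusterAlgebra

/-! ### From mutation relations to the support of a polynomial -/

namespace ClusterAlgebra

section Laurent

open Polynomial

theorem coeff_coeff_swap (Q : ℚ[X][X]) (k l : ℕ) :
    ((Bivariate.swap Q).coeff k).coeff l = (Q.coeff l).coeff k := by
  induction Q using Polynomial.induction_on' with
  | add p q hp hq => simp [hp, hq]
  | monomial i f =>
    induction f using Polynomial.induction_on' with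
    | add p q hp hq => simp only [map_add, coeff_add, hp, hq]
    | monomial j r =>
      rw [Bivariate.swap_monomial_monomial]
      simp only [coeff_monomial]
      split_ifs <;> simp_all [coeff_monomial]

theorem aevalAeval_eq_eval₂ {F : Type*} [Field F] [Algebra ℚ F] (u v : F) (Q : ℚ[X][X]) :
    aevalAeval u v Q = eval₂ (aeval u : ℚ[X] →ₐ[ℚ] F).toRingHom v Q := by
  induction Q using Polynomial.induction_on' with
  | add p q hp hq => simp only [map_add, eval₂_add, hp, hq]
  | monomial i f => simp [← C_mul_X_pow_eq_monomial]

/-- With `T = Q / (u v)^N`, the hypothesis is invariance under `v ↦ v⁻¹ (u^m + 1)` with denominators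
cleared. The shift by `N` turns the exponent symmetry `j ↦ -j` into `k ↦ 2N - k`. -/
theorem coeff_relation {F : Type*} [Field F] [Algebra ℚ F] {u v : F}
    (hinj : Function.Injective (aevalAeval (R := ℚ) u v)) (hv : v ≠ 0) {m N : ℕ} {Q : ℚ[X][X]}
    (hQ : aevalAeval u v Q * (v⁻¹ * (u ^ m + 1)) ^ N =
      aevalAeval u (v⁻¹ * (u ^ m + 1)) Q * v ^ N) (k : ℕ) :
    Q.coeff k * (X ^ m + 1) ^ N =
      if k ≤ 2 * N then Q.coeff (2 * N - k) * (X ^ m + 1) ^ (2 * N - k) else 0 := by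
  set Φ : ℚ[X] := X ^ m + 1 with hΦ
  -- Large enough to clear all powers of `v⁻¹`; the summand `2 * N` keeps `k + D - 2 * N` free of
  -- truncation.
  set D := 2 * N + Q.natDegree with hD
  set P := Q.comp (C Φ * X) with hP
  have hPdeg : P.natDegree ≤ D := by
    rw [hP]
    refine natDegree_comp_le.trans ?_
    have : (C Φ * X).natDegree ≤ 1 := by compute_degree
    nlinarith
  have hev : aevalAeval u v (reflect D P) = aevalAeval u (v⁻¹ * (u ^ m + 1)) Q * v ^ D := by
    have h1 : aevalAeval u (v⁻¹ * (u ^ m + 1)) Q = aevalAeval u v⁻¹ P := by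
      simp only [aevalAeval_eq_eval₂, hP, eval₂_comp, eval₂_mul, eval₂_C, eval₂_X]
      simp [hΦ, mul_comm]
    have := invertibleOfNonzero (inv_ne_zero hv)
    have h2 := eval₂_reflect_mul_pow (aeval u : ℚ[X] →ₐ[ℚ] F).toRingHom v⁻¹ D P hPdeg
    rw [h1, aevalAeval_eq_eval₂, aevalAeval_eq_eval₂, ← h2, invOf_eq_inv, inv_inv, mul_assoc,
      ← mul_pow, inv_mul_cancel₀ hv, one_pow, mul_one]
  have hpoly : Q * C Φ ^ N * X ^ D = reflect D P * X ^ (2 * N) := by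
    apply hinj
    have hC : aevalAeval (R := ℚ) u v (C Φ) = u ^ m + 1 := by
      rw [aevalAeval_C]; simp [hΦ]
    rw [map_mul, map_mul, map_mul, map_pow, map_pow, map_pow, hC, aevalAeval_Y, hev]
    rw [mul_pow] at hQ
    have : aevalAeval u v Q * (u ^ m + 1) ^ N =
        aevalAeval u (v⁻¹ * (u ^ m + 1)) Q * v ^ (2 * N) := by
      have h3 : v⁻¹ ^ N * v ^ N = 1 := by rw [← mul_pow, inv_mul_cancel₀ hv, one_pow]
      linear_combination v ^ N * hQ - aevalAeval u v Q * (u ^ m + 1) ^ N * h3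
    rw [this]; ring
  have hc := congrArg (fun R => coeff R (k + D)) hpoly
  simp only [coeff_mul_X_pow', ← C_pow, coeff_mul_C, Nat.le_add_left, if_true,
    Nat.add_sub_cancel, coeff_reflect] at hc
  rw [if_pos (by omega)] at hc
  rw [hc, hP, comp_C_mul_X_coeff]
  split_ifs with hk
  · rw [revAt_le (by omega), show D - (k + D - 2 * N) = 2 * N - k by omega]
  -- For `k > 2 * N` the index exceeds `D`, where `revAt` is the identity and `P` has no
  -- coefficient.
  · rw [revAt_eq_self_of_lt (by omega), coeff_eq_zero_of_natDegree_lt (by omega), zero_mul]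

theorem exists_coeff_ne_zero_of_relation {F : Type*} [Field F] [Algebra ℚ F] {u v : F}
    (hinj : Function.Injective (aevalAeval (R := ℚ) u v)) (hv : v ≠ 0) {m N : ℕ} (hm : 0 < m)
    {Q : ℚ[X][X]}
    (hQ : aevalAeval u v Q * (v⁻¹ * (u ^ m + 1)) ^ N =
      aevalAeval u (v⁻¹ * (u ^ m + 1)) Q * v ^ N) {k l : ℕ} (hkl : (Q.coeff k).coeff l ≠ 0) :
    k ≤ 2 * N ∧ ∃ l', l + m * N ≤ l' + m * (2 * N - k) ∧ (Q.coeff (2 * N - k)).coeff l' ≠ 0 := by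
  have hrel := coeff_relation hinj hv hQ k
  have hΦ : (X ^ m + 1 : ℚ[X]) ≠ 0 := by simpa using X_pow_add_C_ne_zero hm (1 : ℚ)
  have hdeg : (X ^ m + 1 : ℚ[X]).natDegree = m := by
    simpa using natDegree_X_pow_add_C (n := m) (r := (1 : ℚ))
  have hk0 : Q.coeff k ≠ 0 := fun h => hkl (by rw [h, coeff_zero])
  have hlhs := mul_ne_zero hk0 (pow_ne_zero N hΦ)
  split_ifs at hrel with hk
  · refine ⟨hk, (Q.coeff (2 * N - k)).natDegree, ?_, ?_⟩
    · rw [hrel] at hlhs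
      have := congrArg natDegree hrel
      rw [natDegree_mul hk0 (pow_ne_zero N hΦ),
        natDegree_mul (left_ne_zero_of_mul hlhs) (pow_ne_zero _ hΦ), natDegree_pow, natDegree_pow,
        hdeg] at this
      have hl := le_natDegree_of_ne_zero hkl
      linarith [mul_comm m N, mul_comm m (2 * N - k)]
    · rw [hrel] at hlhs
      simpa using left_ne_zero_of_mul hlhs
  · exact absurd hrel hlhs

theorem eq_zero_of_mutation_relations {F : Type*} [Field F] [Algebra ℚ F] {u v : F}
    (hinj : Function.Injective (aevalAeval (R := ℚ) u v)) (hu : u ≠ 0) (hv : v ≠ 0) {m n N : ℕ}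
    (hmn : 5 ≤ m * n) {Q : ℚ[X][X]}
    (hQ₁ : aevalAeval u v Q * (u⁻¹ * (v ^ n + 1)) ^ N =
      aevalAeval (u⁻¹ * (v ^ n + 1)) v Q * u ^ N)
    (hQ₂ : aevalAeval u v Q * (v⁻¹ * (u ^ m + 1)) ^ N =
      aevalAeval u (v⁻¹ * (u ^ m + 1)) Q * v ^ N)
    (h0 : (Q.coeff N).coeff N = 0) : Q = 0 := by
  have hm : 0 < m := Nat.pos_of_ne_zero fun h => by simp [h] at hmn
  have hn : 0 < n := Nat.pos_of_ne_zero fun h => by simp [h] at hmn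
  -- Swapping the variables reduces the first mutation to the second.
  have hinj' : Function.Injective (aevalAeval (R := ℚ) v u) := fun p q hpq =>
    Bivariate.swap.injective (hinj (by
      rw [Bivariate.aevalAeval_swap, Bivariate.aevalAeval_swap, hpq]))
  -- Exponents of the Laurent polynomial `Q / (u v)^N`: the inner index belongs to `u`, the outer
  -- one to `v`.
  set S : Finset (ℤ × ℤ) := Q.support.biUnion fun k =>
    (Q.coeff k).support.image fun l : ℕ => ((l : ℤ) - N, (k : ℤ) - N) with hS
  have hmem : ∀ i j, (i, j) ∈ S ↔
      ∃ k l : ℕ, (Q.coeff k).coeff l ≠ 0 ∧ i = (l : ℤ) - N ∧ j = (k : ℤ) - N := by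
    intro i j
    simp only [hS, Finset.mem_biUnion, Finset.mem_image, mem_support_iff, Prod.mk.injEq]
    constructor
    · rintro ⟨k, -, l, h, rfl, rfl⟩
      exact ⟨k, l, h, rfl, rfl⟩
    · rintro ⟨k, l, h, rfl, rfl⟩
      exact ⟨k, fun hk => h (by rw [hk, coeff_zero]), l, h, rfl, rfl⟩
  have hempty : S = ∅ := by
    refine eq_empty_of_tropical_invariant (m := m) (n := n) (by exact_mod_cast hn)
      (by exact_mod_cast hmn) ?_ ?_ ?_
    · rw [hmem]
      rintro ⟨k, l, h, hl, hk⟩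
      obtain rfl : k = N := by omega
      obtain rfl : l = k := by omega
      exact h h0
    · intro i j hij
      obtain ⟨k, l, h, rfl, rfl⟩ := (hmem _ _).1 hij
      rw [← coeff_coeff_swap] at h
      obtain ⟨h1, k', h2, h3⟩ := exists_coeff_ne_zero_of_relation hinj' hu hn
        (by simpa only [Bivariate.aevalAeval_swap] using hQ₁) h
      rw [coeff_coeff_swap] at h3
      refine ⟨(k' : ℤ) - N, ?_, (hmem _ _).2 ⟨k', _, h3, ?_, rfl⟩⟩
      · zify [h1] at h2; linarith
      · push_cast [h1]; ring
    · intro i j hij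
      obtain ⟨k, l, h, rfl, rfl⟩ := (hmem _ _).1 hij
      obtain ⟨h1, l', h2, h3⟩ := exists_coeff_ne_zero_of_relation hinj hv hm hQ₂ h
      refine ⟨(l' : ℤ) - N, ?_, (hmem _ _).2 ⟨_, l', h3, rfl, ?_⟩⟩
      · zify [h1] at h2; linarith
      · push_cast [h1]; ring
  ext k l
  by_contra h
  have : ((l : ℤ) - N, (k : ℤ) - N) ∈ S := (hmem _ _).2 ⟨k, l, h, rfl, rfl⟩
  simp [hempty] at this

end Laurent

end ClusterAlgebra

/-! ### Clearing denominators and evaluating at seeds -/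

namespace ClusterAlgebra

section Substitution

open Polynomial

/-- The inclusion of the polynomials in two variables into the rational functions. -/
local notation "𝕏" => algebraMap (MvPolynomial (Fin 2) ℚ) (FractionRing (MvPolynomial (Fin 2) ℚ))

theorem exists_mul_pow_eq_of_mem_laurentPolynomials
    {T : FractionRing (MvPolynomial (Fin 2) ℚ)} (hT : T ∈ laurentPolynomials 2) :
    ∃ (N : ℕ) (p : MvPolynomial (Fin 2) ℚ),
      T * 𝕏 (MvPolynomial.X 0 * MvPolynomial.X 1) ^ N = 𝕏 p := by
  have hne : ∀ i : Fin 2, 𝕏 (MvPolynomial.X i) ≠ 0 := fun i => by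
    simp [MvPolynomial.X_ne_zero]
  induction hT using Algebra.adjoin_induction with
  | mem T hT =>
    rcases hT with ⟨i, rfl⟩ | ⟨i, rfl⟩
    · exact ⟨0, MvPolynomial.X i, by simp⟩
    · have h0 := hne 0
      have h1 := hne 1
      fin_cases i
      · refine ⟨1, MvPolynomial.X 1, ?_⟩
        simp only [Fin.zero_eta, pow_one, map_mul]
        field_simp
      · refine ⟨1, MvPolynomial.X 0, ?_⟩
        simp only [Fin.mk_one, pow_one, map_mul]
        field_simp
  | algebraMap r =>
    exact ⟨0, MvPolynomial.C r, by
      simp [IsScalarTower.algebraMap_apply ℚ (MvPolynomial (Fin 2) ℚ)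
        (FractionRing (MvPolynomial (Fin 2) ℚ)), MvPolynomial.algebraMap_eq]⟩
  | add S T _ _ hS hT =>
    obtain ⟨N, p, hp⟩ := hS
    obtain ⟨M, q, hq⟩ := hT
    refine ⟨N + M, p * (MvPolynomial.X 0 * MvPolynomial.X 1) ^ M +
      q * (MvPolynomial.X 0 * MvPolynomial.X 1) ^ N, ?_⟩
    rw [map_add, map_mul 𝕏 p, map_mul 𝕏 q, ← hp, ← hq, map_pow, map_pow]
    ring
  | mul S T _ _ hS hT =>
    obtain ⟨N, p, hp⟩ := hS
    obtain ⟨M, q, hq⟩ := hT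
    refine ⟨N + M, p * q, ?_⟩
    rw [map_mul 𝕏 p, ← hp, ← hq]
    ring

variable {F : Type*} [Field F] [Algebra ℚ F]

theorem Seed.eval_algebraMap (S : Seed 2 F) (p : MvPolynomial (Fin 2) ℚ) :
    S.eval (𝕏 p) = MvPolynomial.aeval S.x p :=
  IsFractionRing.lift_algebraMap (g := (MvPolynomial.aeval S.x : _ →ₐ[ℚ] F).toRingHom)
    S.algebraicIndependent p

theorem aeval_equivMvPolynomial (x : Fin 2 → F) (Q : ℚ[X][X]) :
    MvPolynomial.aeval x (Bivariate.equivMvPolynomial ℚ Q) = aevalAeval (x 0) (x 1) Q := by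
  rw [Bivariate.equivMvPolynomial]
  change ((MvPolynomial.aeval x).comp (aevalAeval (MvPolynomial.X 0) (MvPolynomial.X 1))) Q = _
  congr 1
  apply (aevalAevalEquiv ℚ F).symm.injective
  simp [aevalAevalEquiv]

theorem Seed.eval_mul_pow {T : FractionRing (MvPolynomial (Fin 2) ℚ)} {N : ℕ} {Q : ℚ[X][X]}
    (hT : T * 𝕏 (MvPolynomial.X 0 * MvPolynomial.X 1) ^ N = 𝕏 (Bivariate.equivMvPolynomial ℚ Q))
    (S : Seed 2 F) : S.eval T * (S.x 0 * S.x 1) ^ N = aevalAeval (S.x 0) (S.x 1) Q := by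
  have := congrArg S.eval hT
  rw [map_mul, map_pow, S.eval_algebraMap, S.eval_algebraMap, aeval_equivMvPolynomial] at this
  simpa using this

theorem Seed.injective_aevalAeval (S : Seed 2 F) :
    Function.Injective (aevalAeval (R := ℚ) (S.x 0) (S.x 1)) := fun p q hpq =>
  (Bivariate.equivMvPolynomial ℚ).injective <| S.algebraicIndependent <| by
    rw [aeval_equivMvPolynomial, aeval_equivMvPolynomial, hpq]

theorem Seed.eq_zero_of_eval_mutate_eq {S : Seed 2 F} {m n : ℕ} (hmn : 5 ≤ m * n)
    (hB : S.B = !![0, (m : ℤ); -(n : ℤ), 0]) {T : FractionRing (MvPolynomial (Fin 2) ℚ)}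
    (hT : ∀ k, (S.mutate k).eval T = S.eval T) {N : ℕ} {Q : ℚ[X][X]}
    (hQ : T * 𝕏 (MvPolynomial.X 0 * MvPolynomial.X 1) ^ N = 𝕏 (Bivariate.equivMvPolynomial ℚ Q))
    (h0 : (Q.coeff N).coeff N = 0) : T = 0 := by
  have hS := S.eval_mul_pow hQ
  have hQ0 : Q = 0 := by
    refine eq_zero_of_mutation_relations S.injective_aevalAeval (S.x_ne_zero 0) (S.x_ne_zero 1)
      hmn (m := m) (n := n) (N := N) ?_ ?_ h0
    · have h := (S.mutate 0).eval_mul_pow hQ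
      have hx0 : (S.mutate 0).x 0 = (S.x 0)⁻¹ * (S.x 1 ^ n + 1) := by
        simp [Seed.mutate, mutateCluster, hB, add_comm]
      have hx1 : (S.mutate 0).x 1 = S.x 1 := by simp [Seed.mutate, mutateCluster]
      rw [hT, hx0, hx1] at h
      rw [← h, ← hS]
      simp only [mul_pow]
      ring
    · have h := (S.mutate 1).eval_mul_pow hQ
      have hx0 : (S.mutate 1).x 1 = (S.x 1)⁻¹ * (S.x 0 ^ m + 1) := by
        simp [Seed.mutate, mutateCluster, hB]
      have hx1 : (S.mutate 1).x 0 = S.x 0 := by simp [Seed.mutate, mutateCluster]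
      rw [hT, hx0, hx1] at h
      rw [← h, ← hS]
      simp only [mul_pow]
      ring
  rw [hQ0, map_zero, map_zero] at hQ
  refine (mul_eq_zero.1 hQ).resolve_right (pow_ne_zero _ ?_)
  simp [MvPolynomial.X_ne_zero]

theorem ClusterPattern.not_isLaurentMutationInvariant {V : Type*} {𝕋 : RegularTree 2 V}
    (P : ClusterPattern 𝕋 F) (t₀ : V) {m n : ℕ} (hmn : 5 ≤ m * n)
    (hB : (P.seed t₀).B = !![0, (m : ℤ); -(n : ℤ), 0])
    (T : FractionRing (MvPolynomial (Fin 2) ℚ)) : ¬ P.IsLaurentMutationInvariant t₀ T := by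
  rintro ⟨⟨hconst, hinv⟩, hL⟩
  obtain ⟨N, p, hp⟩ := exists_mul_pow_eq_of_mem_laurentPolynomials hL
  obtain ⟨Q, rfl⟩ := (Bivariate.equivMvPolynomial ℚ).surjective p
  set c := (Q.coeff N).coeff N with hc
  refine hconst ⟨c, sub_eq_zero.1 ?_⟩
  -- The constant `c` has numerator `c (x₁ x₂)^N` over the common denominator; removing it kills the
  -- `(N, N)` coefficient of `Q`.
  refine Seed.eq_zero_of_eval_mutate_eq hmn hB (N := N)
    (Q := Q - C (C c * X ^ N) * X ^ N) (fun k => ?_) ?_ ?_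
  · obtain ⟨t, ⟨ht, hk⟩, -⟩ := 𝕋.existsUnique_adj t₀ k
    have h := P.seed_eq_mutate t₀ t ht
    rw [hk] at h
    rw [← h, map_sub, map_sub, ← hinv t]
    simp
  · rw [sub_mul, hp, map_sub, map_sub]
    congr 1
    simp only [map_mul, map_pow, Bivariate.equivMvPolynomial_C_C, Bivariate.equivMvPolynomial_C_X,
      Bivariate.equivMvPolynomial_X]
    rw [← MvPolynomial.algebraMap_eq, ← IsScalarTower.algebraMap_apply]
    ring
  · rw [coeff_sub, coeff_sub, coeff_C_mul_X_pow, if_pos rfl, coeff_C_mul_X_pow, if_pos rfl, hc,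
      sub_self]

end Substitution

end ClusterAlgebra

theorem mainTheorem1 {F : Type*} [Field F] [Algebra ℚ F] {V : Type*}
    (𝕋 : ClusterAlgebra.RegularTree 2 V) (P : ClusterAlgebra.ClusterPattern 𝕋 F) (t₀ : V)
    (m n : ℕ) (hmn : 5 ≤ m * n) (hB : (P.seed t₀).B = !![0, (m : ℤ); -(n : ℤ), 0]) :
    ¬ ∃ T : FractionRing (MvPolynomial (Fin 2) ℚ), P.IsLaurentMutationInvariant t₀ T := by
  rintro ⟨T, hT⟩
  exact P.not_isLaurentMutationInvariant t₀ hmn hB T hT
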